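/- Let $\mathfrak{H}=\mathbb{Q}\langle x,y\rangle$ be the noncommutative polynomial ring in two indeterminates $x,y$, and let $\mathfrak{H}^0=\mathbb{Q}+x\mathfrak{H}y$. Put $z=x+y$ and $z_k=x^{k-1}y$ for $k\ge 1$. For integers $k_1\ge 2$ and $k_2,\dots,k_r\ge 1$ let \[ \zeta(k_1,\dots,k_r)=\sum_{n_1>\cdots>n_r\ge 1}\frac{1}{n_1^{k_1}\cdots n_r^{k_r}}, \] and let $Z\colon\mathfrak{H}^0\to\mathbb{R}$ be the $\mathbb{Q}$-linear map with $Z(1)=1$ and $Z(z_{k_1}\cdots z_{k_r})=\zeta(k_1,\dots,k_r)$ for all such $k_1,\dots,k_r$ ($r\ge 1$). For $l\ge 1$ let $\partial_l\colon\mathfrak{H}\to\mathfrak{H}$ be the unique $\mathbb{Q}$-linear map with $\partial_l(ww')=\partial_l(w)w'+w\,\partial_l(w')$ for all $w,w'\in\mathfrak{H}$, $\partial_l(x)=xz^{l-1}y$ and $\partial_l(y)=-xz^{l-1}y$; it maps $\mathfrak{H}^0$ into itself. Then, for every integer $l\ge 1$ and every $w\in\mathfrak{H}^0$, \[ Z(\partial_l(w))=0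 . \] -/

import Mathlib

noncomputable section

namespace MZV

/-- The two letters of the alphabet. -/
inductive Letter : Type
  | X : Letter
  | Y : Letter

/-- The noncommutative polynomial ring `𝔥 = ℚ⟨x, y⟩`. -/
abbrev H : Type := FreeAlgebra ℚ Letter

/-- The indeterminate `x` of `𝔥`. -/
def x : H := FreeAlgebra.ι ℚ Letter.X

/-- The indeterminate `y` of `𝔥`. -/
def y : H := FreeAlgebra.ι ℚ Letter.Y

/-- `z = x + y`. -/
def z : H := x + y

/-- `𝔥⁰ = ℚ + x 𝔥 y`, as a `ℚ`-subspace of `𝔥`. -/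
def H0 : Submodule ℚ H :=
  Submodule.span ℚ {1} ⊔
    LinearMap.range (LinearMap.mulLeft ℚ x ∘ₗ LinearMap.mulRight ℚ y)

/-- The word `z_k = x^(k-1) y`, used for `k ≥ 1`. -/
def zWord (k : ℕ) : H := x ^ (k - 1) * y

/-- The multiple zeta value
`ζ(k₁, …, k_r) = ∑_{n₁ > ⋯ > n_r ≥ 1} 1 / (n₁^k₁ ⋯ n_r^k_r)`. -/
def zeta (k : List ℕ) : ℝ :=
  ∑' n : {n : Fin k.length → ℕ // StrictAnti n ∧ ∀ i, 1 ≤ n i},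
    ∏ i : Fin k.length, 1 / (n.1 i : ℝ) ^ k.get i

/-- The list `(k₁, …, k_r)` with `w = x^(k₁-1) y ⋯ x^(k_r-1) y`, for a word `w` that is empty or
ends in `y` (for other words the final block of `x`'s is ignored). -/
def wordIndex : List Letter → List ℕ
  | [] => []
  | Letter.Y :: w => 1 :: wordIndex w
  | Letter.X :: w =>
    match wordIndex w with
    | [] => []
    | k :: ks => (k + 1) :: ks

/-- The `ℚ`-linear map `Z : 𝔥⁰ → ℝ` with `Z(1) = 1` and `Z(z_{k₁} ⋯ z_{k_r}) = ζ(k₁, …, k_r)`: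
the restriction to `𝔥⁰` of the linear map given on the basis of words through `wordIndex`;
see `Z_one` and `Z_zWord`. -/
def Z : H0 →ₗ[ℚ] ℝ :=
  ((FreeAlgebra.basisFreeMonoid ℚ Letter).constr ℚ
    (fun w : FreeMonoid Letter => zeta (wordIndex (FreeMonoid.toList w)))) ∘ₗ H0.subtype

/-- The images of the letters under `∂_l`: `x ↦ x z^(l-1) y` and `y ↦ - x z^(l-1) y`. -/
def partialLetter (l : ℕ) : Letter → H
  | Letter.X => x * z ^ (l - 1) * y
  | Letter.Y => -(x * z ^ (l - 1) * y)

/-- The algebra map `w ↦ (w, ∂_l(w))` into the square-zero extension of `𝔥` by itself. -/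
def partialLift (l : ℕ) : H →ₐ[ℚ] TrivSqZeroExt H H :=
  FreeAlgebra.lift ℚ fun a =>
    TrivSqZeroExt.inl (FreeAlgebra.ι ℚ a) + TrivSqZeroExt.inr (partialLetter l a)

/-- The derivation `∂_l` of `𝔥` with `∂_l(x) = x z^(l-1) y` and `∂_l(y) = - x z^(l-1) y`, for
`l ≥ 1`; see `partialD_mul`, `partialD_x`, `partialD_y` and `partialD_unique`. -/
def partialD (l : ℕ) : H →ₗ[ℚ] H :=
  TrivSqZeroExt.sndHom H H |>.restrictScalars ℚ |>.comp (partialLift l).toLinearMap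

theorem partialLift_fst (l : ℕ) (w : H) : (partialLift l w).fst = w := by
  have h : (TrivSqZeroExt.fstHom ℚ H H).comp (partialLift l) = AlgHom.id ℚ H := by
    apply FreeAlgebra.hom_ext
    funext a
    simp [partialLift]
  exact DFunLike.congr_fun h w

theorem partialD_apply (l : ℕ) (w : H) : partialD l w = (partialLift l w).snd := rfl

theorem partialD_x (l : ℕ) : partialD l x = x * z ^ (l - 1) * y := by
  simp [partialD_apply, partialLift, x, partialLetter]

theorem partialD_y (l : ℕ) : partialD l y = -(x * z ^ (l - 1) * y) := by
  simp [partialD_apply, partialLift, y, partialLetter]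

/-- Leibniz's rule. -/
theorem partialD_mul (l : ℕ) (v w : H) :
    partialD l (v * w) = partialD l v * w + v * partialD l w := by
  simp [partialD_apply, partialLift_fst, add_comm]

theorem partialD_one (l : ℕ) : partialD l 1 = 0 := by
  simp [partialD_apply]

/-- A derivation of `𝔥` is determined by its values at `x` and `y`. -/
theorem partialD_unique (l : ℕ) (d : H →ₗ[ℚ] H)
    (hmul : ∀ v w, d (v * w) = d v * w + v * d w)
    (hx : d x = x * z ^ (l - 1) * y) (hy : d y = -(x * z ^ (l - 1) * y)) :
    d = partialD l := by
  have h1 : d 1 = 0 := by simpa using hmul 1 1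
  ext w
  induction w using FreeAlgebra.induction with
  | grade0 r =>
    rw [Algebra.algebraMap_eq_smul_one, map_smul, map_smul, h1, partialD_one]
  | grade1 a =>
    cases a with
    | X => exact hx.trans (partialD_x l).symm
    | Y => exact hy.trans (partialD_y l).symm
  | mul a b ha hb => rw [hmul, partialD_mul, ha, hb]
  | add a b ha hb => rw [map_add, map_add, ha, hb]

theorem mem_H0_iff (w : H) : w ∈ H0 ↔ ∃ (q : ℚ) (v : H), w = algebraMap ℚ H q + x * v * y := by
  simp only [H0, Submodule.mem_sup, Submodule.mem_span_singleton, LinearMap.mem_range]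
  constructor
  · rintro ⟨_, ⟨q, rfl⟩, _, ⟨v, rfl⟩, rfl⟩
    exact ⟨q, v, by simp [Algebra.algebraMap_eq_smul_one, mul_assoc]⟩
  · rintro ⟨q, v, rfl⟩
    exact ⟨_, ⟨q, rfl⟩, _, ⟨v, rfl⟩, by simp [Algebra.algebraMap_eq_smul_one, mul_assoc]⟩

/-- `∂_l` maps `𝔥⁰` into itself. -/
theorem partialD_mem_H0 (l : ℕ) {w : H} (hw : w ∈ H0) : partialD l w ∈ H0 := by
  obtain ⟨q, v, rfl⟩ := (mem_H0_iff w).1 hw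
  refine (mem_H0_iff _).2
    ⟨0, z ^ (l - 1) * y * v + partialD l v - v * x * z ^ (l - 1), ?_⟩
  rw [map_add, Algebra.algebraMap_eq_smul_one, map_smul, partialD_one, partialD_mul, partialD_mul,
    partialD_x, partialD_y]
  simp only [map_zero, smul_zero]
  noncomm_ring

theorem one_mem_H0 : (1 : H) ∈ H0 := (mem_H0_iff 1).2 ⟨1, 0, by simp⟩

theorem zWord_prod_mem_H0 (k : ℕ) (ks : List ℕ) (hk : 2 ≤ k) :
    ((k :: ks).map zWord).prod ∈ H0 := by
  have hlast : ∀ (v : H) (ks : List ℕ), ∃ u : H, v * y * (ks.map zWord).prod = u * y := by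
    intro v ks
    induction ks generalizing v with
    | nil => exact ⟨v, by simp⟩
    | cons m ms ih =>
      obtain ⟨u, hu⟩ := ih (v * y * x ^ (m - 1))
      exact ⟨u, by rw [← hu]; simp [zWord, mul_assoc]⟩
  obtain ⟨j, rfl⟩ : ∃ j, k = j + 2 := ⟨k - 2, by omega⟩
  obtain ⟨u, hu⟩ := hlast (x ^ j) ks
  refine (mem_H0_iff _).2 ⟨0, u, ?_⟩
  rw [mul_assoc, ← hu]
  simp [zWord, pow_succ', mul_assoc]

/-- The word `z_{k₁} ⋯ z_{k_r}` as a list of letters. -/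
def indexWord : List ℕ → List Letter
  | [] => []
  | k :: ks => List.replicate (k - 1) Letter.X ++ Letter.Y :: indexWord ks

theorem wordIndex_indexWord (ks : List ℕ) (hks : ∀ k ∈ ks, 1 ≤ k) :
    wordIndex (indexWord ks) = ks := by
  have hrep : ∀ (j : ℕ) (w : List Letter),
      wordIndex (List.replicate j Letter.X ++ Letter.Y :: w) = (j + 1) :: wordIndex w := by
    intro j w
    induction j with
    | zero => simp [wordIndex]
    | succ j ih => simp [List.replicate_succ, wordIndex, ih]
  induction ks with
  | nil => rfl
  | cons k ks ih =>
    rw [indexWord, hrep, ih fun m hm => hks m (List.mem_cons_of_mem _ hm)]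
    have := hks k List.mem_cons_self
    congr 1
    omega

theorem basis_indexWord (ks : List ℕ) :
    FreeAlgebra.basisFreeMonoid ℚ Letter (FreeMonoid.ofList (indexWord ks)) =
      (ks.map zWord).prod := by
  have hb : ∀ w : FreeMonoid Letter, FreeAlgebra.basisFreeMonoid ℚ Letter w =
      FreeMonoid.lift (FreeAlgebra.ι ℚ) w := by
    intro w
    simp [FreeAlgebra.basisFreeMonoid, FreeAlgebra.equivMonoidAlgebraFreeMonoid]
  rw [hb]
  induction ks with
  | nil => simp [indexWord]
  | cons k ks ih =>
    rw [indexWord, FreeMonoid.ofList_append, FreeMonoid.ofList_cons, map_mul, map_mul, ih]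
    simp [zWord, x, y, FreeMonoid.lift_apply, mul_assoc]

theorem Z_one : Z ⟨1, one_mem_H0⟩ = 1 := by
  have h := basis_indexWord []
  simp only [List.map_nil, List.prod_nil] at h
  simp only [Z, LinearMap.comp_apply, Submodule.subtype_apply]
  rw [← h, Module.Basis.constr_basis]
  let u : Unique {n : Fin ([] : List ℕ).length → ℕ // StrictAnti n ∧ ∀ i, 1 ≤ n i} :=
    { default := ⟨Fin.elim0, fun i => i.elim0, fun i => i.elim0⟩
      uniq := fun n => Subtype.ext (funext fun i => i.elim0) }
  change zeta [] = 1
  rw [zeta, tsum_eq_single u.default fun n hn => (hn (u.uniq n)).elim]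
  exact Finset.prod_eq_one fun i => i.elim0

theorem Z_zWord (k : ℕ) (ks : List ℕ) (hk : 2 ≤ k) (hks : ∀ m ∈ ks, 1 ≤ m) :
    Z ⟨((k :: ks).map zWord).prod, zWord_prod_mem_H0 k ks hk⟩ = zeta (k :: ks) := by
  simp only [Z, LinearMap.comp_apply, Submodule.subtype_apply]
  rw [← basis_indexWord, Module.Basis.constr_basis, FreeMonoid.toList_ofList,
    wordIndex_indexWord]
  intro m hm
  rcases List.mem_cons.1 hm with rfl | hm
  · omega
  · exact hks m hm

end MZV

end

/-!
Let `S : 𝔥 → 𝔥⟦t⟧` be the homomorphism `x ↦ x`, `y ↦ (1 - x t)⁻¹ y`, and let `T` be its conjugate by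
the duality anti-automorphism, so `T` is `x ↦ x (1 - y t)⁻¹`, `y ↦ y`. Ohno's relation and duality
say that `Z ∘ S = Z ∘ T` on `𝔥⁰`. Both come from the connected sums of Seki and Yamamoto: for a
real `t ∈ [0, 1/2]`, shifting the denominators of the letter `y` by `t` turns the multiple zeta
value of `w` into the generating function of `Z (S w)`, and a telescoping sum moves the letters of
`w` one at a time to a second factor, where they reappear as those of the dual word. Comparing
power series coefficients gives Ohno's relation.

Following Ihara, Kaneko and Zagier, `T` is the composition of `S` with the homomorphism `Δ` given by
`x ↦ x (1 - y t)⁻¹`, `z ↦ z`. By induction on the degree in `t`, `Z` annihilates every positive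
coefficient of `Δ` on `𝔥⁰`. Finally `Δ` is the exponential of the derivation `∑ n, (t ^ n / n) ∂_n`,
that is `t Δ' = Δ ∘ ∑ n, t ^ n ∂_n`, and reading off the coefficients shows that `Z` annihilates the
image of every `∂_n`.
-/

noncomputable section

namespace MZV

open PowerSeries Finset

section NoncommutativePowerSeries

theorem sum_antidiagonal_exchange {M : Type*} [AddCommMonoid M] (F : ℕ → ℕ → ℕ → ℕ → M) (n : ℕ) :
    ∑ p ∈ antidiagonal n, ∑ q ∈ antidiagonal p.1, ∑ r ∈ antidiagonal p.2, F q.1 q.2 r.1 r.2 =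
      ∑ p ∈ antidiagonal n, ∑ q ∈ antidiagonal p.1, ∑ r ∈ antidiagonal p.2,
        F q.1 r.1 q.2 r.2 := by
  simp only [sum_sigma']
  refine sum_nbij'
    (fun s => ⟨(s.2.1.1 + s.2.2.1, s.2.1.2 + s.2.2.2), (s.2.1.1, s.2.2.1), (s.2.1.2, s.2.2.2)⟩)
    (fun s => ⟨(s.2.1.1 + s.2.2.1, s.2.1.2 + s.2.2.2), (s.2.1.1, s.2.2.1), (s.2.1.2, s.2.2.2)⟩)
    ?_ ?_ ?_ ?_ ?_
  all_goals
    rintro ⟨⟨a, b⟩, ⟨c, d⟩, ⟨e, f⟩⟩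
    simp only [mem_sigma, HasAntidiagonal.mem_antidiagonal]
    rintro ⟨h, rfl, rfl⟩
    simp [← h, add_add_add_comm]

variable {k A B : Type*} [CommSemiring k] [Semiring A] [Semiring B] [Algebra k A] [Algebra k B]

/-- The extension of an algebra homomorphism `φ : A → B⟦X⟧` to `A⟦X⟧` that fixes `X`, used to
compose one-parameter families of homomorphisms. It is written coefficientwise because Mathlib's
substitution of power series needs commutative coefficients. -/
def seriesExtension (φ : A →ₐ[k] B⟦X⟧) : A⟦X⟧ →ₐ[k] B⟦X⟧ :=
  AlgHom.ofLinearMap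
    { toFun := fun f => PowerSeries.mk fun n =>
        ∑ p ∈ antidiagonal n, coeff p.1 (φ (coeff p.2 f))
      map_add' := fun f g => by
        ext
        simp [sum_add_distrib]
      map_smul' := fun c f => by
        ext
        simp [smul_sum] }
    (by
      ext n
      cases n <;> simp [Nat.sum_antidiagonal_succ', coeff_one])
    (fun f g => by
      ext n
      simp only [LinearMap.coe_mk, AddHom.coe_mk, coeff_mk, coeff_mul, map_sum, map_mul,
        sum_mul_sum]
      exact (sum_congr rfl fun _ _ => sum_comm).trans
        (sum_antidiagonal_exchange
          (fun a b c d => coeff a (φ (coeff b f)) * coeff c (φ (coeff d g))) n).symm)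

theorem coeff_seriesExtension (φ : A →ₐ[k] B⟦X⟧) (f : A⟦X⟧) (n : ℕ) :
    coeff n (seriesExtension φ f) = ∑ p ∈ antidiagonal n, coeff p.1 (φ (coeff p.2 f)) := by
  simp [seriesExtension]

theorem seriesExtension_C (φ : A →ₐ[k] B⟦X⟧) (a : A) : seriesExtension φ (C a) = φ a := by
  ext n
  cases n <;> simp [coeff_seriesExtension, Nat.sum_antidiagonal_succ', coeff_C]

theorem seriesExtension_X_mul (φ : A →ₐ[k] B⟦X⟧) (f : A⟦X⟧) :
    seriesExtension φ (X * f) = X * seriesExtension φ f := by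
  ext n
  cases n <;>
    simp only [coeff_seriesExtension, Nat.sum_antidiagonal_succ', coeff_succ_X_mul,
      coeff_zero_X_mul, HasAntidiagonal.antidiagonal_zero, sum_singleton, map_zero, zero_add]

/-- The Euler operator `X d/dX`; unlike `d/dX` it shifts no coefficients. -/
def eulerOperator (k : Type*) {A : Type*} [CommSemiring k] [Semiring A] [Algebra k A] :
    A⟦X⟧ →ₗ[k] A⟦X⟧ where
  toFun f := PowerSeries.mk fun n => n • coeff n f
  map_add' f g := by
    ext
    simp
  map_smul' c f := by
    ext n
    simp

theorem coeff_eulerOperator (f : A⟦X⟧) (n : ℕ) : coeff n (eulerOperator k f) = n • coeff n f := by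
  simp [eulerOperator]

theorem eulerOperator_C (a : A) : eulerOperator k (C a) = 0 := by
  ext n
  rw [coeff_eulerOperator, coeff_C]
  split <;> simp [*]

theorem eulerOperator_one : eulerOperator k (1 : A⟦X⟧) = 0 :=
  eulerOperator_C 1

theorem eulerOperator_X : eulerOperator k (X : A⟦X⟧) = X := by
  ext n
  rw [coeff_eulerOperator, coeff_X]
  split <;> simp [*]

theorem eulerOperator_mul (f g : A⟦X⟧) :
    eulerOperator k (f * g) = eulerOperator k f * g + f * eulerOperator k g := by
  ext n
  simp only [coeff_eulerOperator, coeff_mul, map_add, smul_sum, ← sum_add_distrib]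
  refine sum_congr rfl fun p hp => ?_
  rw [← HasAntidiagonal.mem_antidiagonal.1 hp, add_smul, smul_mul_assoc, mul_smul_comm]

end NoncommutativePowerSeries

section GeometricSeries

variable {k A B : Type*} [CommSemiring k] [Ring A] [Ring B] [Algebra k A] [Algebra k B]

/-- The inverse `∑ n, p ^ n * X ^ n` of `1 - X * p`, for `p` in a noncommutative ring. -/
def geometricSeries (p : A) : A⟦X⟧ := PowerSeries.mk fun n => p ^ n

theorem geometricSeries_eq (p : A) : geometricSeries p = 1 + X * (C p * geometricSeries p) := by
  ext n
  cases n <;> simp [geometricSeries, coeff_succ_X_mul, coeff_one, pow_succ']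

theorem commute_C_geometricSeries (p : A) : Commute (C p) (geometricSeries p) := by
  ext n
  simp [geometricSeries, ← pow_succ, ← pow_succ']

theorem one_sub_mul_geometricSeries (p : A) : (1 - X * C p) * geometricSeries p = 1 := by
  rw [sub_mul, one_mul, mul_assoc, sub_eq_iff_eq_add, ← geometricSeries_eq]

theorem geometricSeries_mul_one_sub (p : A) : geometricSeries p * (1 - X * C p) = 1 := by
  refine Eq.trans ?_ (one_sub_mul_geometricSeries p)
  exact ((Commute.one_right _).sub_right
    ((commute_X _).mul_right (commute_C_geometricSeries p).symm)).eq

theorem seriesExtension_geometricSeries_mul (φ : A →ₐ[k] B⟦X⟧) (p : A) :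
    seriesExtension φ (geometricSeries p) * (1 - X * φ p) = 1 := by
  rw [← seriesExtension_C φ p, ← seriesExtension_X_mul, ← map_one (seriesExtension φ), ← map_sub,
    ← map_mul, geometricSeries_mul_one_sub]

theorem seriesExtension_geometricSeries (φ : A →ₐ[k] B⟦X⟧) {p : A} {q : B} (h : φ p = C q) :
    seriesExtension φ (geometricSeries p) = geometricSeries q :=
  left_inv_eq_right_inv (h ▸ seriesExtension_geometricSeries_mul φ p)
    (one_sub_mul_geometricSeries q)

theorem eulerOperator_geometricSeries (p : A) :
    eulerOperator k (geometricSeries p) =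
      X * (geometricSeries p * (C p * geometricSeries p)) := by
  have h : (1 - X * C p) * eulerOperator k (geometricSeries p) =
      X * (C p * geometricSeries p) := by
    rw [sub_mul, one_mul, sub_eq_iff_eq_add]
    nth_rw 1 [geometricSeries_eq]
    simp only [map_add, eulerOperator_mul, eulerOperator_X, eulerOperator_C, eulerOperator_one]
    noncomm_ring
  rw [← one_mul (eulerOperator k _), ← geometricSeries_mul_one_sub p, mul_assoc, h, ← mul_assoc,
    (commute_X _).eq, mul_assoc]

end GeometricSeries

section OneParameterFamilies

theorem eq_of_leibniz {k α A : Type*} [CommSemiring k] [Ring A] [Algebra k A]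
    (s : FreeAlgebra k α →ₐ[k] A) {D E : FreeAlgebra k α →ₗ[k] A}
    (hD : ∀ v w, D (v * w) = D v * s w + s v * D w)
    (hE : ∀ v w, E (v * w) = E v * s w + s v * E w)
    (h : ∀ a, D (FreeAlgebra.ι k a) = E (FreeAlgebra.ι k a)) : D = E := by
  have apply_one {F : FreeAlgebra k α →ₗ[k] A}
      (hF : ∀ v w, F (v * w) = F v * s w + s v * F w) : F 1 = 0 := by
    simpa using hF 1 1
  ext w
  induction w using FreeAlgebra.induction with
  | grade0 r => simp only [Algebra.algebraMap_eq_smul_one, map_smul, apply_one hD, apply_one hE]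
  | grade1 a => exact h a
  | mul v w hv hw => rw [hD, hE, hv, hw]
  | add v w hv hw => rw [map_add, map_add, hv, hw]

theorem coeff_zero_apply_of_coeff_zero_ι {k α : Type*} [CommSemiring k]
    (f : FreeAlgebra k α →ₐ[k] (FreeAlgebra k α)⟦X⟧)
    (h : ∀ a, coeff 0 (f (FreeAlgebra.ι k a)) = FreeAlgebra.ι k a) (w : FreeAlgebra k α) :
    coeff 0 (f w) = w := by
  induction w using FreeAlgebra.induction with
  | grade0 r => simp [Algebra.algebraMap_eq_smul_one]
  | grade1 a => exact h a
  | mul v w hv hw => simp_all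
  | add v w hv hw => rw [map_add, map_add, hv, hw]

/-- The homomorphism `x ↦ x`, `y ↦ (1 - x t)⁻¹ y` into power series in `t`, whose coefficients are
the sums over the increments of the indices in Ohno's relation. -/
def ohnoHom : H →ₐ[ℚ] H⟦X⟧ :=
  FreeAlgebra.lift ℚ fun
    | Letter.X => C x
    | Letter.Y => geometricSeries x * C y

/-- The homomorphism `x ↦ x (1 - y t)⁻¹`, `y ↦ y`: the conjugate of `ohnoHom` by duality. -/
def dualOhnoHom : H →ₐ[ℚ] H⟦X⟧ :=
  FreeAlgebra.lift ℚ fun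
    | Letter.X => C x * geometricSeries y
    | Letter.Y => C y

/-- The homomorphism `x ↦ x (1 - y t)⁻¹`, `z ↦ z`, which is the exponential of the derivation
`∑ n, (t ^ n / n) ∂_n`; see `eulerOperator_derivationExp`. -/
def derivationExp : H →ₐ[ℚ] H⟦X⟧ :=
  FreeAlgebra.lift ℚ fun
    | Letter.X => C x * geometricSeries y
    | Letter.Y => C z - C x * geometricSeries y

theorem ohnoHom_x : ohnoHom x = C x := by simp [ohnoHom, x]

theorem ohnoHom_y : ohnoHom y = geometricSeries x * C y := by simp [ohnoHom, y]

theorem dualOhnoHom_x : dualOhnoHom x = C x * geometricSeries y := by simp [dualOhnoHom, x]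

theorem dualOhnoHom_y : dualOhnoHom y = C y := by simp [dualOhnoHom, y]

theorem derivationExp_x : derivationExp x = C x * geometricSeries y := by simp [derivationExp, x]

theorem derivationExp_y : derivationExp y = C z - derivationExp x := by
  simp [derivationExp, x, y]

theorem derivationExp_z : derivationExp z = C z := by
  rw [z, map_add, derivationExp_y, add_sub_cancel, z]

theorem derivationExp_y_eq_one_sub_mul : derivationExp y = (1 - X * derivationExp x) * C y := by
  have h := commute_C_geometricSeries y
  rw [derivationExp_y, derivationExp_x, z, map_add]
  nth_rw 1 [geometricSeries_eq]
  rw [h.eq, mul_add, ← mul_assoc (C x) X, (commute_X (C x)).eq]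
  noncomm_ring

theorem coeff_zero_derivationExp (w : H) : coeff 0 (derivationExp w) = w :=
  coeff_zero_apply_of_coeff_zero_ι derivationExp
    (fun
      | Letter.X => by simp [derivationExp, x, geometricSeries]
      | Letter.Y => by simp [derivationExp, x, y, z, geometricSeries]) w

theorem seriesExtension_derivationExp_comp_ohnoHom :
    (seriesExtension derivationExp).comp ohnoHom = dualOhnoHom := by
  refine FreeAlgebra.hom_ext (funext fun a => ?_)
  cases a with
  | X =>
    change seriesExtension derivationExp (ohnoHom x) = dualOhnoHom x
    rw [ohnoHom_x, seriesExtension_C, derivationExp_x, dualOhnoHom_x]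
  | Y =>
    change seriesExtension derivationExp (ohnoHom y) = dualOhnoHom y
    rw [ohnoHom_y, map_mul, seriesExtension_C, derivationExp_y_eq_one_sub_mul, dualOhnoHom_y,
      ← mul_assoc, seriesExtension_geometricSeries_mul, one_mul]

/-- The generating series `∑ j, ∂_{j+1} t ^ j` of the derivations. -/
def derivationSeries : H →ₗ[ℚ] H⟦X⟧ where
  toFun w := PowerSeries.mk fun j => partialD (j + 1) w
  map_add' v w := by
    ext
    simp
  map_smul' c w := by
    ext
    simp

theorem coeff_derivationSeries (w : H) (n : ℕ) :
    coeff n (derivationSeries w) = partialD (n + 1) w := by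
  simp [derivationSeries]

theorem derivationSeries_mul (v w : H) :
    derivationSeries (v * w) = derivationSeries v * C w + C v * derivationSeries w := by
  ext n
  simp [coeff_derivationSeries, partialD_mul]

theorem derivationSeries_x : derivationSeries x = C x * geometricSeries z * C y := by
  ext n
  simp [coeff_derivationSeries, partialD_x, geometricSeries, mul_assoc]

theorem derivationSeries_y : derivationSeries y = -derivationSeries x := by
  ext n
  simp [coeff_derivationSeries, partialD_x, partialD_y]

theorem geometricSeries_z_mul_derivationExp_y :
    geometricSeries z * derivationExp y = C y * geometricSeries y := by
  have h : derivationExp y = (1 - X * C z) * (C y * geometricSeries y) := by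
    have hy := one_sub_mul_geometricSeries y
    have hc := commute_C_geometricSeries y
    calc derivationExp y
        = ((1 - X * C y) * geometricSeries y) * C y - X * C x * geometricSeries y * C y := by
          rw [derivationExp_y_eq_one_sub_mul, derivationExp_x, hy]
          noncomm_ring
      _ = _ := by
          rw [mul_assoc _ _ (C y), mul_assoc _ _ (C y), ← hc.eq, z, map_add]
          noncomm_ring
  rw [h, ← mul_assoc, geometricSeries_mul_one_sub, one_mul]

theorem eulerOperator_derivationExp (w : H) :
    eulerOperator ℚ (derivationExp w) =
      X * seriesExtension derivationExp (derivationSeries w) := by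
  have hx : eulerOperator ℚ (derivationExp x) =
      X * seriesExtension derivationExp (derivationSeries x) := by
    rw [derivationSeries_x, map_mul, map_mul, seriesExtension_C, seriesExtension_C,
      seriesExtension_geometricSeries _ derivationExp_z, mul_assoc,
      geometricSeries_z_mul_derivationExp_y, derivationExp_x, eulerOperator_mul, eulerOperator_C,
      eulerOperator_geometricSeries, zero_mul, zero_add, ← mul_assoc, (commute_X (C x)).eq]
    noncomm_ring
  suffices h : eulerOperator ℚ ∘ₗ derivationExp.toLinearMap =
      LinearMap.mulLeft ℚ X ∘ₗ (seriesExtension derivationExp).toLinearMap ∘ₗ derivationSeries from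
    LinearMap.congr_fun h w
  refine eq_of_leibniz derivationExp (fun v w => ?_) (fun v w => ?_) fun a => ?_
  · simp [eulerOperator_mul]
  · simp only [LinearMap.comp_apply, AlgHom.toLinearMap_apply, LinearMap.mulLeft_apply,
      derivationSeries_mul, map_add, map_mul (seriesExtension _), seriesExtension_C]
    rw [mul_assoc, ← mul_assoc (derivationExp v), (commute_X (derivationExp v)).eq,
      mul_assoc]
  · cases a with
    | X => exact hx
    | Y =>
      change eulerOperator ℚ (derivationExp y) =
        X * seriesExtension derivationExp (derivationSeries y)
      rw [derivationExp_y, map_sub, eulerOperator_C, zero_sub, hx, derivationSeries_y, map_neg,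
        mul_neg]

end OneParameterFamilies

section Duality

/-- The duality of `𝔥`: the anti-automorphism exchanging `x` and `y`. -/
def dual : H →ₗ[ℚ] H :=
  (MulOpposite.opLinearEquiv ℚ).symm.toLinearMap ∘ₗ
    (FreeAlgebra.lift ℚ fun
      | Letter.X => MulOpposite.op y
      | Letter.Y => MulOpposite.op x : H →ₐ[ℚ] Hᵐᵒᵖ).toLinearMap

theorem dual_mul (v w : H) : dual (v * w) = dual w * dual v := by simp [dual]

theorem dual_one : dual 1 = 1 := by simp [dual]

theorem dual_x : dual x = y := by simp [dual, x]

theorem dual_y : dual y = x := by simp [dual, y]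

theorem dual_pow (w : H) (n : ℕ) : dual (w ^ n) = dual w ^ n := by
  induction n with
  | zero => rw [pow_zero, pow_zero, dual_one]
  | succ n ih => rw [pow_succ, dual_mul, ih, pow_succ']

/-- The coefficient of `t ^ n` in `ohnoHom`. -/
def ohnoCoeff (n : ℕ) : H →ₗ[ℚ] H :=
  (PowerSeries.coeff (R := H) n).restrictScalars ℚ ∘ₗ ohnoHom.toLinearMap

theorem ohnoCoeff_apply (n : ℕ) (w : H) : ohnoCoeff n w = coeff n (ohnoHom w) := rfl

theorem ohnoCoeff_mul (n : ℕ) (v w : H) :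
    ohnoCoeff n (v * w) = ∑ p ∈ antidiagonal n, ohnoCoeff p.1 v * ohnoCoeff p.2 w := by
  simp [ohnoCoeff_apply, coeff_mul]

theorem ohnoCoeff_one (n : ℕ) : ohnoCoeff n 1 = if n = 0 then 1 else 0 := by
  simp [ohnoCoeff_apply, coeff_one]

theorem ohnoCoeff_x_mul (n : ℕ) (w : H) : ohnoCoeff n (x * w) = x * ohnoCoeff n w := by
  simp [ohnoCoeff_apply, ohnoHom_x]

theorem ohnoCoeff_y (n : ℕ) : ohnoCoeff n y = x ^ n * y := by
  simp [ohnoCoeff_apply, ohnoHom_y, geometricSeries]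

theorem ohnoCoeff_zero (w : H) : ohnoCoeff 0 w = w :=
  coeff_zero_apply_of_coeff_zero_ι ohnoHom
    (fun | Letter.X => by simp [ohnoHom, x] | Letter.Y => by simp [ohnoHom, y, geometricSeries]) w

theorem coeff_dualOhnoHom (n : ℕ) (w : H) :
    coeff n (dualOhnoHom w) = dual (ohnoCoeff n (dual w)) := by
  induction w using FreeAlgebra.induction generalizing n with
  | grade0 r =>
    rw [Algebra.algebraMap_eq_smul_one]
    by_cases hn : n = 0 <;> simp [dual_one, ohnoCoeff_one, coeff_one, hn]
  | grade1 a =>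
    cases a with
    | X =>
      change coeff n (dualOhnoHom x) = dual (ohnoCoeff n (dual x))
      rw [dual_x, ohnoCoeff_y, dual_mul, dual_pow, dual_x, dual_y, dualOhnoHom_x, coeff_C_mul,
        geometricSeries, coeff_mk]
    | Y =>
      change coeff n (dualOhnoHom y) = dual (ohnoCoeff n (dual y))
      rw [dual_y, dualOhnoHom_y, ohnoCoeff_apply, ohnoHom_x, coeff_C, coeff_C]
      split <;> simp [dual_x]
  | mul v w hv hw =>
    rw [map_mul, coeff_mul, dual_mul, ohnoCoeff_mul, map_sum, ← Nat.sum_antidiagonal_swap]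
    simp only [dual_mul, hv, hw, Prod.fst_swap, Prod.snd_swap]
  | add v w hv hw => simp only [map_add, hv, hw]

end Duality

section Words

theorem map_mem_H0 {f : H →ₗ[ℚ] H} (h_one : f 1 ∈ H0) (h : ∀ v, f (x * v * y) ∈ H0) {w : H}
    (hw : w ∈ H0) : f w ∈ H0 := by
  obtain ⟨q, v, rfl⟩ := (mem_H0_iff w).1 hw
  rw [Algebra.algebraMap_eq_smul_one, map_add, map_smul]
  exact H0.add_mem (H0.smul_mem q h_one) (h v)

theorem x_mul_mul_y_mem_H0 (v : H) : x * v * y ∈ H0 :=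
  (mem_H0_iff _).2 ⟨0, v, by simp⟩

theorem dual_mem_H0 {w : H} (hw : w ∈ H0) : dual w ∈ H0 := by
  refine map_mem_H0 ?_ (fun v => ?_) hw
  · exact dual_one.symm ▸ one_mem_H0
  · rw [dual_mul, dual_mul, dual_x, dual_y, ← mul_assoc]
    exact x_mul_mul_y_mem_H0 _

theorem ohnoCoeff_mem_H0 (n : ℕ) {w : H} (hw : w ∈ H0) : ohnoCoeff n w ∈ H0 := by
  refine map_mem_H0 ?_ (fun v => ?_) hw
  · rw [ohnoCoeff_one]
    split
    · exact one_mem_H0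
    · exact H0.zero_mem
  · simp only [mul_assoc, ohnoCoeff_x_mul, ohnoCoeff_mul n v, ohnoCoeff_y, mul_sum]
    refine H0.sum_mem fun p _ => ?_
    simpa only [mul_assoc] using x_mul_mul_y_mem_H0 (ohnoCoeff p.1 v * x ^ p.2)

/-- The element of `𝔥` given by a word. -/
def word (u : List Letter) : H := (u.map (FreeAlgebra.ι ℚ)).prod

theorem word_nil : word [] = 1 := rfl

theorem word_x_cons (u : List Letter) : word (Letter.X :: u) = x * word u := List.prod_cons

theorem word_y_cons (u : List Letter) : word (Letter.Y :: u) = y * word u := List.prod_cons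

theorem word_append (u v : List Letter) : word (u ++ v) = word u * word v := by simp [word]

theorem x_mul_word_mul_y_eq (u : List Letter) : x * word u * y = x * word (u ++ [Letter.Y]) := by
  rw [word_append, word_y_cons, word_nil, mul_one, mul_assoc]

theorem exists_dual_word_eq (u : List Letter) : ∃ v, dual (word u) = word v := by
  induction u with
  | nil => exact ⟨[], dual_one⟩
  | cons a u ih =>
    obtain ⟨v, hv⟩ := ih
    cases a with
    | X => exact ⟨v ++ [Letter.Y], by
        rw [word_x_cons, dual_mul, hv, dual_x, word_append, word_y_cons, word_nil, mul_one]⟩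
    | Y => exact ⟨v ++ [Letter.X], by
        rw [word_y_cons, dual_mul, hv, dual_y, word_append, word_x_cons, word_nil, mul_one]⟩

theorem word_indexWord (ks : List ℕ) : word (indexWord ks) = (ks.map zWord).prod := by
  induction ks with
  | nil => rfl
  | cons k ks ih =>
    rw [indexWord, word_append, word_y_cons, ih]
    simp [word, zWord, x, mul_assoc]

theorem span_range_word : Submodule.span ℚ (Set.range word) = ⊤ := by
  have h : ⇑(FreeAlgebra.basisFreeMonoid ℚ Letter) = fun u => word (FreeMonoid.toList u) := by
    ext u
    simp [FreeAlgebra.basisFreeMonoid, FreeAlgebra.equivMonoidAlgebraFreeMonoid, word,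
      FreeMonoid.lift_apply]
  rw [← (FreeAlgebra.basisFreeMonoid ℚ Letter).span_eq, h]
  exact congrArg _ (FreeMonoid.toList.surjective.range_comp word).symm

theorem H0_eq_span :
    H0 = Submodule.span ℚ (insert 1 (Set.range fun u : List Letter => x * word u * y)) := by
  rw [H0, LinearMap.range_eq_map, ← span_range_word, Submodule.map_span, ← Submodule.span_union,
    ← Set.range_comp, Set.singleton_union]
  simp only [Function.comp_def, LinearMap.comp_apply, LinearMap.mulLeft_apply,
    LinearMap.mulRight_apply, mul_assoc]

theorem x_mul_zWord_succ (k : ℕ) : x * zWord (k + 1) = zWord (k + 2) := by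
  simp [zWord, pow_succ', mul_assoc]

theorem exists_word_mul_y_eq (u : List Letter) :
    ∃ k ks, (∀ m ∈ ks, 1 ≤ m) ∧ word u * y = (((k + 1) :: ks).map zWord).prod := by
  induction u with
  | nil => exact ⟨0, [], by simp [word, zWord]⟩
  | cons a u ih =>
    obtain ⟨k, ks, hks, hu⟩ := ih
    cases a with
    | X =>
      refine ⟨k + 1, ks, hks, ?_⟩
      rw [word_x_cons, mul_assoc, hu, List.map_cons, List.prod_cons, ← mul_assoc, x_mul_zWord_succ]
      rfl
    | Y =>
      refine ⟨0, (k + 1) :: ks, by simpa using hks, ?_⟩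
      rw [word_y_cons, mul_assoc, hu, List.map_cons, List.map_cons, List.prod_cons]
      simp [zWord]

theorem exists_x_mul_word_mul_y_eq (u : List Letter) :
    ∃ k ks, 2 ≤ k ∧ (∀ m ∈ ks, 1 ≤ m) ∧ x * word u * y = ((k :: ks).map zWord).prod := by
  obtain ⟨k, ks, hks, hu⟩ := exists_word_mul_y_eq u
  refine ⟨k + 2, ks, by omega, hks, ?_⟩
  rw [mul_assoc, hu, List.map_cons, List.map_cons, List.prod_cons, List.prod_cons, ← mul_assoc,
    x_mul_zWord_succ]

/-- The linear extension to `𝔥` of `Z` underlying its definition. -/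
def zetaMap : H →ₗ[ℚ] ℝ :=
  (FreeAlgebra.basisFreeMonoid ℚ Letter).constr ℚ fun w => zeta (wordIndex (FreeMonoid.toList w))

theorem Z_eq_zetaMap (w : H0) : Z w = zetaMap w := rfl

end Words

section NestedSums

/-- The action of the letters on sequences for which `w ↦ w · δ₀` builds the nested sums of `w`
from the innermost summation variable outwards; the parameter `t` shifts the denominators of the
letter `y`. Both letters give the value `0` at the index `0`, by division by zero for `x` and as an
empty sum for `y`. -/
def letterOperator (t : ℝ) : Letter → Module.End ℚ (ℕ → ℝ)
  | Letter.X =>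
    { toFun := fun f m => f m / m
      map_add' := fun f g => by
        ext
        simp [add_div]
      map_smul' := fun c f => by
        ext
        simp [mul_div_assoc, Rat.smul_def] }
  | Letter.Y =>
    { toFun := fun f m => (∑ j ∈ range m, f j) / (m - t)
      map_add' := fun f g => by
        ext
        simp [sum_add_distrib, add_div]
      map_smul' := fun c f => by
        ext
        simp [← mul_sum, mul_div_assoc, Rat.smul_def] }

/-- The nested sum of `w` with outermost summation variable `m`. -/
def nestedSum (t : ℝ) : H →ₗ[ℚ] ℕ → ℝ :=
  LinearMap.applyₗ (Pi.single 0 1) ∘ₗ (FreeAlgebra.lift ℚ (letterOperator t)).toLinearMap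

theorem nestedSum_one (t : ℝ) : nestedSum t 1 = Pi.single 0 1 := by
  simp [nestedSum]

theorem nestedSum_x_mul (t : ℝ) (w : H) :
    nestedSum t (x * w) = letterOperator t Letter.X (nestedSum t w) := by
  simp [nestedSum, x]

theorem nestedSum_y_mul (t : ℝ) (w : H) :
    nestedSum t (y * w) = letterOperator t Letter.Y (nestedSum t w) := by
  simp [nestedSum, y]

theorem nestedSum_x_mul_apply (t : ℝ) (w : H) (m : ℕ) :
    nestedSum t (x * w) m = nestedSum t w m / m := by
  rw [nestedSum_x_mul]
  rfl

theorem nestedSum_y_mul_apply (t : ℝ) (w : H) (m : ℕ) :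
    nestedSum t (y * w) m = (∑ j ∈ range m, nestedSum t w j) / (m - t) := by
  rw [nestedSum_y_mul]
  rfl

theorem nestedSum_x_pow_mul_apply (t : ℝ) (n : ℕ) (w : H) (m : ℕ) :
    nestedSum t (x ^ n * w) m = nestedSum t w m / m ^ n := by
  induction n with
  | zero => simp
  | succ n ih => rw [pow_succ', mul_assoc, nestedSum_x_mul_apply, ih, div_div, ← pow_succ]

theorem nestedSum_word_nonneg {t : ℝ} (ht : t < 1) (u : List Letter) (m : ℕ) :
    0 ≤ nestedSum t (word u) m := by
  induction u generalizing m with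
  | nil =>
    rw [word_nil, nestedSum_one, Pi.single_apply]
    split <;> norm_num
  | cons a u ih =>
    cases a with
    | X =>
      rw [word_x_cons, nestedSum_x_mul_apply]
      exact div_nonneg (ih m) m.cast_nonneg
    | Y =>
      rw [word_y_cons, nestedSum_y_mul_apply]
      rcases m.eq_zero_or_pos with rfl | hm
      · simp
      · have : (1 : ℝ) ≤ m := by exact_mod_cast hm
        exact div_nonneg (sum_nonneg fun j _ => ih j) (by linarith)

theorem nestedSum_zWord_mul_apply {k : ℕ} (hk : 1 ≤ k) (w : H) (m : ℕ) :
    nestedSum 0 (zWord k * w) m = (∑ j ∈ range m, nestedSum 0 w j) / m ^ k := by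
  rw [zWord, mul_assoc, nestedSum_x_pow_mul_apply, nestedSum_y_mul_apply, sub_zero, div_div,
    ← pow_succ', Nat.sub_add_cancel hk]

end NestedSums

section Zeta

open scoped ENNReal

/-- The sum defining `zeta`, in `ℝ≥0∞` and with the summation variables restricted to `s`. -/
def indexSum (s : Set ℕ) (ks : List ℕ) : ℝ≥0∞ :=
  ∑' n : Fin ks.length → ℕ, {n | StrictAnti n ∧ ∀ i, 1 ≤ n i ∧ n i ∈ s}.indicator
    (fun n => ∏ i, ENNReal.ofReal (1 / (n i : ℝ) ^ ks.get i)) n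

theorem zeta_eq_toReal_indexSum (ks : List ℕ) : zeta ks = (indexSum Set.univ ks).toReal := by
  simp only [indexSum, Set.mem_univ, and_true]
  rw [← _root_.tsum_subtype, ENNReal.tsum_toReal_eq fun n =>
    ENNReal.prod_ne_top fun i _ => ENNReal.ofReal_ne_top]
  refine tsum_congr fun n => ?_
  rw [ENNReal.toReal_prod]
  exact prod_congr rfl fun i _ => (ENNReal.toReal_ofReal (by positivity)).symm

theorem strictAnti_cons_and_iff {s : Set ℕ} (hs : IsLowerSet s) {r m : ℕ} {n : Fin r → ℕ} :
    (StrictAnti (Fin.cons m n : Fin (r + 1) → ℕ) ∧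
        ∀ i, 1 ≤ (Fin.cons m n : Fin (r + 1) → ℕ) i ∧ (Fin.cons m n : Fin (r + 1) → ℕ) i ∈ s) ↔
      (1 ≤ m ∧ m ∈ s) ∧ StrictAnti n ∧ ∀ i, 1 ≤ n i ∧ n i ∈ Set.Iio m := by
  have h : StrictAnti (Fin.cons m n : Fin (r + 1) → ℕ) ↔ (∀ i, n i < m) ∧ StrictAnti n :=
    Fin.liftFun_cons (· > ·)
  simp only [h, Fin.forall_fin_succ, Fin.cons_zero, Fin.cons_succ, Set.mem_Iio]
  constructor
  · rintro ⟨⟨hlt, hn⟩, hm, h⟩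
    exact ⟨hm, hn, fun i => ⟨(h i).1, hlt i⟩⟩
  · rintro ⟨hm, hn, h⟩
    exact ⟨⟨fun i => (h i).2, hn⟩, hm, fun i => ⟨(h i).1, hs (h i).2.le hm.2⟩⟩

theorem indexSum_nil (s : Set ℕ) : indexSum s [] = 1 := by
  refine (tsum_fintype (β := Fin 0 → ℕ) _).trans ((Fintype.sum_unique _).trans ?_)
  simp [StrictAnti]

theorem indexSum_cons {s : Set ℕ} (hs : IsLowerSet s) (k : ℕ) (ks : List ℕ) :
    indexSum s (k :: ks) = ∑' m : ℕ, {m | 1 ≤ m ∧ m ∈ s}.indicator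
      (fun m => ENNReal.ofReal (1 / (m : ℝ) ^ k) * indexSum (Set.Iio m) ks) m := by
  classical
  refine ((Fin.consEquiv fun _ : Fin (ks.length + 1) => ℕ).tsum_eq _).symm.trans
    ((ENNReal.summable.tsum_prod' fun _ => ENNReal.summable).trans (tsum_congr fun m => ?_))
  simp only [Set.indicator_apply, Set.mem_ofPred_eq, Fin.consEquiv_apply]
  split_ifs with hm
  · rw [indexSum, ← ENNReal.tsum_mul_left]
    refine tsum_congr fun n => ?_
    have h := strictAnti_cons_and_iff hs (m := m) (n := n)
    by_cases hn : n ∈ {n : Fin ks.length → ℕ | StrictAnti n ∧ ∀ i, 1 ≤ n i ∧ n i ∈ Set.Iio m}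
    · rw [Set.indicator_of_mem hn]
      exact (if_pos (h.2 ⟨hm, hn⟩)).trans (Fin.prod_univ_succ _)
    · rw [Set.indicator_of_notMem hn, mul_zero]
      exact if_neg fun h' => hn (h.1 h').2
  · refine ENNReal.tsum_eq_zero.2 fun n => if_neg fun h => hm ?_
    exact ((strictAnti_cons_and_iff hs).1 h).1

theorem indexSum_eq_tsum_nestedSum {s : Set ℕ} (hs : IsLowerSet s) (hs0 : 0 ∈ s) {ks : List ℕ}
    (hks : ∀ k ∈ ks, 1 ≤ k) :
    indexSum s ks =
      ∑' m : ℕ, s.indicator (fun m => ENNReal.ofReal (nestedSum 0 (ks.map zWord).prod m)) m := by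
  classical
  induction ks generalizing s with
  | nil =>
    rw [indexSum_nil, tsum_eq_single 0]
    · simp [nestedSum_one, hs0]
    · intro m hm
      simp [nestedSum_one, hm]
  | cons k ks ih =>
    rw [indexSum_cons hs]
    refine tsum_congr fun m => ?_
    rw [List.map_cons, List.prod_cons]
    simp only [Set.indicator_apply, Set.mem_ofPred_eq, nestedSum_zWord_mul_apply (hks k (by simp))]
    rcases m.eq_zero_or_pos with rfl | hm
    · simp
    have hnonneg (j : ℕ) : 0 ≤ nestedSum 0 (ks.map zWord).prod j :=
      word_indexWord ks ▸ nestedSum_word_nonneg one_pos _ j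
    rw [ih (isLowerSet_Iio m) hm fun j hj => hks j (by simp [hj]),
      tsum_eq_sum (s := range m) fun j hj => Set.indicator_of_notMem (by simpa using hj) _,
      sum_congr rfl fun j hj => Set.indicator_of_mem (by simpa using hj) _,
      ← ENNReal.ofReal_sum_of_nonneg fun j _ => hnonneg j, ← ENNReal.ofReal_mul (by positivity),
      one_div_mul_eq_div]
    simp [Nat.one_le_iff_ne_zero, hm.ne']

end Zeta

section Convergence

open Real

theorem sum_range_one_div_sqrt_le (m : ℕ) : ∑ j ∈ range m, 1 / √(j + 1 : ℝ) ≤ 2 * √m := by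
  induction m with
  | zero => simp
  | succ m ih =>
    have ha : 0 < √(m + 1 : ℝ) := by positivity
    have hab : √(m + 1 : ℝ) ^ 2 = √(m : ℝ) ^ 2 + 1 := by
      rw [sq_sqrt (by positivity), sq_sqrt (by positivity)]
    have h : 1 / √(m + 1 : ℝ) ≤ 2 * √(m + 1 : ℝ) - 2 * √m := by
      rw [div_le_iff₀ ha]
      linarith [sq_nonneg (√(m + 1 : ℝ) - √m)]
    rw [sum_range_succ]
    push_cast
    linarith

theorem sum_range_div_le_of_le_div_sqrt {t : ℝ} (ht : t ≤ 1 / 2) {f : ℕ → ℝ} {c : ℝ} (hc : 0 ≤ c)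
    (h : ∀ j : ℕ, f j ≤ c / √(j + 1)) (m : ℕ) :
    (∑ j ∈ range m, f j) / (m - t) ≤ 8 * c / √(m + 1) := by
  rcases m.eq_zero_or_pos with rfl | hm
  · simpa using hc
  have hm' : (1 : ℝ) ≤ m := by exact_mod_cast hm
  have hsqrt : √(m + 1 : ℝ) ≤ 2 * √m := by
    rw [sqrt_le_left (by positivity), mul_pow, sq_sqrt m.cast_nonneg]
    linarith
  have hsum : ∑ j ∈ range m, f j ≤ c * (2 * √m) :=
    calc ∑ j ∈ range m, f j ≤ ∑ j ∈ range m, c / √(j + 1 : ℝ) := sum_le_sum fun j _ => h j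
      _ = c * ∑ j ∈ range m, 1 / √(j + 1 : ℝ) := by simp_rw [div_eq_mul_one_div c, ← mul_sum]
      _ ≤ c * (2 * √m) := by gcongr; exact sum_range_one_div_sqrt_le m
  calc (∑ j ∈ range m, f j) / (m - t)
      ≤ c * (2 * √m) / (m - t) := by gcongr; linarith
    _ ≤ c * (2 * √m) / (m / 2) := by gcongr; linarith
    _ = 4 * c / √m := by
      rw [div_eq_div_iff (by positivity) (by positivity)]
      linear_combination 2 * c * mul_self_sqrt m.cast_nonneg
    _ ≤ 8 * c / √(m + 1) := by
      rw [div_le_div_iff₀ (by positivity) (by positivity)]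
      linarith [mul_le_mul_of_nonneg_left hsqrt hc]

-- The true rate `(log m) ^ r / m` depends on `u`; the weaker rate `1 / √m` is kept by each letter.
theorem exists_nestedSum_word_le {t : ℝ} (ht : t ≤ 1 / 2) (u : List Letter) :
    ∃ c, ∀ m : ℕ, nestedSum t (word u) m ≤ c / √(m + 1) := by
  have hnonneg := fun (u : List Letter) (m : ℕ) =>
    nestedSum_word_nonneg (show t < 1 by linarith) u m
  induction u with
  | nil =>
    refine ⟨1, fun m => ?_⟩
    rw [word_nil, nestedSum_one, Pi.single_apply]
    split_ifs with hm
    · simp [hm]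
    · positivity
  | cons a u ih =>
    obtain ⟨c, hc⟩ := ih
    have hc0 : 0 ≤ c := by simpa using (hnonneg u 0).trans (hc 0)
    cases a with
    | X =>
      refine ⟨c, fun m => ?_⟩
      rw [word_x_cons, nestedSum_x_mul_apply]
      rcases m.eq_zero_or_pos with rfl | hm
      · simpa using hc0
      · exact (div_le_self (hnonneg u m) (by exact_mod_cast hm)).trans (hc m)
    | Y =>
      refine ⟨8 * c, fun m => ?_⟩
      rw [word_y_cons, nestedSum_y_mul_apply]
      exact sum_range_div_le_of_le_div_sqrt ht hc0 hc m

theorem summable_nestedSum_x_mul_word {t : ℝ} (ht : t ≤ 1 / 2) (u : List Letter) :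
    Summable (nestedSum t (x * word u)) := by
  obtain ⟨c, hc⟩ := exists_nestedSum_word_le ht u
  have hnonneg := nestedSum_word_nonneg (show t < 1 by linarith)
  have hc0 : 0 ≤ c := by simpa using (hnonneg u 0).trans (hc 0)
  refine Summable.of_nonneg_of_le (word_x_cons u ▸ hnonneg (Letter.X :: u)) (fun m => ?_)
    ((summable_one_div_nat_rpow.2 (show 1 < (3 / 2 : ℝ) by norm_num)).mul_left c)
  rw [nestedSum_x_mul_apply]
  rcases m.eq_zero_or_pos with rfl | hm
  · simp
  have hpow : (m : ℝ) ^ (3 / 2 : ℝ) = √m * m := by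
    rw [show (3 / 2 : ℝ) = 1 / 2 + 1 by norm_num, rpow_add (by positivity), rpow_one, sqrt_eq_rpow]
  rw [hpow, mul_one_div, ← div_div]
  gcongr
  refine (hc m).trans ?_
  gcongr
  linarith

theorem zetaMap_one : zetaMap 1 = 1 := Z_one

theorem zetaMap_zWord {k : ℕ} {ks : List ℕ} (hk : 2 ≤ k) (hks : ∀ m ∈ ks, 1 ≤ m) :
    zetaMap ((k :: ks).map zWord).prod = zeta (k :: ks) :=
  Z_zWord k ks hk hks

theorem zetaMap_x_mul_word_mul_y (u : List Letter) :
    zetaMap (x * word u * y) = ∑' m, nestedSum 0 (x * word u * y) m := by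
  have hnonneg (m : ℕ) : 0 ≤ nestedSum 0 (x * word u * y) m := by
    rw [x_mul_word_mul_y_eq, ← word_x_cons]
    exact nestedSum_word_nonneg one_pos _ m
  obtain ⟨k, ks, hk, hks, hu⟩ := exists_x_mul_word_mul_y_eq u
  have hks' : ∀ j ∈ k :: ks, 1 ≤ j := by
    simpa using ⟨by omega, hks⟩
  rw [hu] at hnonneg ⊢
  rw [zetaMap_zWord hk hks, zeta_eq_toReal_indexSum,
    indexSum_eq_tsum_nestedSum isLowerSet_univ (Set.mem_univ 0) hks']
  simp only [Set.indicator_univ]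
  rw [ENNReal.tsum_toReal_eq fun m => ENNReal.ofReal_ne_top]
  exact tsum_congr fun m => ENNReal.toReal_ofReal (hnonneg m)

theorem hasSum_nestedSum {w : H} (hw : w ∈ H0) : HasSum (nestedSum 0 w) (zetaMap w) := by
  rw [H0_eq_span] at hw
  induction hw using Submodule.span_induction with
  | mem w hw =>
    rcases hw with rfl | ⟨u, rfl⟩
    · rw [nestedSum_one, zetaMap_one]
      exact hasSum_pi_single 0 1
    · have h := summable_nestedSum_x_mul_word (t := 0) (by norm_num) (u ++ [Letter.Y])
      rw [← x_mul_word_mul_y_eq] at h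
      exact zetaMap_x_mul_word_mul_y u ▸ h.hasSum
  | zero =>
    rw [map_zero, map_zero]
    exact hasSum_zero
  | add v w _ _ hv hw =>
    rw [map_add, map_add]
    exact hv.add hw
  | smul q w _ hw =>
    rw [map_smul, map_smul]
    exact hw.const_smul q

end Convergence

section ConnectedSums

open Filter Topology
open scoped ENNReal

/-- The product `(1 - t) (2 - t) ⋯ (n - t)`, a shifted factorial. -/
def shiftFactorial (t : ℝ) (n : ℕ) : ℝ := ∏ j ∈ range n, ((j : ℝ) + 1 - t)

theorem shiftFactorial_pos {t : ℝ} (ht : t < 1) (n : ℕ) : 0 < shiftFactorial t n :=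
  prod_pos fun j _ => by linarith [j.cast_nonneg (α := ℝ)]

theorem shiftFactorial_succ (t : ℝ) (n : ℕ) :
    shiftFactorial t (n + 1) = shiftFactorial t n * ((n : ℝ) + 1 - t) := by
  rw [shiftFactorial, prod_range_succ, shiftFactorial]

/-- The connector of Seki and Yamamoto, which couples the outermost summation variables of two
nested sums. -/
def connector (t : ℝ) (m n : ℕ) : ℝ :=
  shiftFactorial t m * shiftFactorial t n / shiftFactorial t (m + n)

theorem connector_comm (t : ℝ) (m n : ℕ) : connector t m n = connector t n m := by
  rw [connector, connector, mul_comm, add_comm]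

variable {t : ℝ}

theorem connector_nonneg (ht : t < 1) (m n : ℕ) : 0 ≤ connector t m n :=
  div_nonneg (mul_nonneg (shiftFactorial_pos ht m).le (shiftFactorial_pos ht n).le)
    (shiftFactorial_pos ht _).le

theorem connector_zero_right (ht : t < 1) (m : ℕ) : connector t m 0 = 1 := by
  rw [connector, add_zero, shiftFactorial, shiftFactorial, prod_range_zero, mul_one]
  exact div_self (shiftFactorial_pos ht m).ne'

theorem connector_succ_mul (ht : t < 1) (m n : ℕ) :
    connector t m (n + 1) * ((m : ℝ) + n + 1 - t) = connector t m n * ((n : ℝ) + 1 - t) := by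
  have h := (shiftFactorial_pos ht (m + n)).ne'
  have hmn : ((m + n : ℕ) : ℝ) + 1 - t ≠ 0 := by
    linarith [(m + n).cast_nonneg (α := ℝ)]
  rw [connector, connector, ← add_assoc, shiftFactorial_succ, shiftFactorial_succ]
  push_cast at hmn ⊢
  field_simp

theorem connector_succ_div (ht : t < 1) {m : ℕ} (hm : 1 ≤ m) (n : ℕ) :
    connector t m (n + 1) / ((n + 1 : ℕ) - t) =
      connector t m n / m - connector t m (n + 1) / m := by
  have h := connector_succ_mul ht m n
  have hn : (n : ℝ) + 1 - t ≠ 0 := by linarith [n.cast_nonneg (α := ℝ)]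
  push_cast
  field_simp
  linarith

theorem connector_le (ht0 : 0 ≤ t) (ht : t < 1) {m : ℕ} (hm : 1 ≤ m) (n : ℕ) :
    connector t m n ≤ 1 / ((n : ℝ) + 1 - t) := by
  have hn : (0 : ℝ) ≤ n := n.cast_nonneg
  induction m, hm using Nat.le_induction with
  | base =>
    have hone : shiftFactorial t 1 ≤ 1 := by simpa [shiftFactorial] using ht0
    rw [connector, add_comm 1 n, shiftFactorial_succ t n, mul_comm,
      mul_div_mul_left _ _ (shiftFactorial_pos ht n).ne']
    gcongr
    linarith
  | succ m _ ih =>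
    refine le_trans ?_ ih
    have h := connector_succ_mul ht n m
    rw [connector_comm t n, connector_comm t n] at h
    have hpos : 0 < (m : ℝ) + 1 - t := by linarith [m.cast_nonneg (α := ℝ)]
    refine le_of_mul_le_mul_right ?_ hpos
    linarith [mul_nonneg hn (connector_nonneg ht (m + 1) n)]

theorem tendsto_connector (ht0 : 0 ≤ t) (ht : t < 1) {m : ℕ} (hm : 1 ≤ m) :
    Tendsto (connector t m) atTop (𝓝 0) := by
  refine squeeze_zero (connector_nonneg ht m) (connector_le ht0 ht hm) ?_
  refine tendsto_const_nhds.div_atTop ?_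
  exact tendsto_atTop_add_const_right _ _
    (tendsto_atTop_add_const_right _ _ tendsto_natCast_atTop_atTop)

theorem connector_div_nonneg (ht : t < 1) (m : ℕ) {n : ℕ} (hn : 0 < n) :
    0 ≤ connector t m n / (n - t) := by
  have : (1 : ℝ) ≤ n := by exact_mod_cast hn
  exact div_nonneg (connector_nonneg ht m n) (by linarith)

theorem hasSum_connector (ht0 : 0 ≤ t) (ht : t < 1) {m : ℕ} (hm : 1 ≤ m) (n : ℕ) :
    HasSum (fun k : ℕ => connector t m (n + k + 1) / ((n + k + 1 : ℕ) - t))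
      (connector t m n / m) := by
  rw [hasSum_iff_tendsto_nat_of_nonneg fun k => connector_div_nonneg ht m (n + k).succ_pos]
  have htelescope (N : ℕ) :
      ∑ k ∈ range N, connector t m (n + k + 1) / ((n + k + 1 : ℕ) - t) =
        connector t m n / m - connector t m (n + N) / m := by
    simp_rw [connector_succ_div ht hm]
    exact sum_range_sub' (fun k => connector t m (n + k) / m) N
  simp_rw [htelescope]
  have hlim : Tendsto (fun N => connector t m (n + N) / m) atTop (𝓝 (0 / m)) :=
    ((tendsto_connector ht0 ht hm).comp
      (tendsto_atTop_mono (fun N => Nat.le_add_left N n) tendsto_id)).div_const _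
  simpa using tendsto_const_nhds.sub hlim

theorem tsum_tsum_add_succ (h : ℕ → ℕ → ℝ≥0∞) :
    ∑' n, ∑' k, h n (n + k + 1) = ∑' a, ∑ n ∈ range a, h n a := by
  have hfiber (a : ℕ) :
      ∑' p : antidiagonal a, h p.1.1 (p.1.1 + p.1.2 + 1) = ∑ n ∈ range (a + 1), h n (a + 1) := by
    rw [tsum_fintype, sum_coe_sort (antidiagonal a) fun p => h p.1 (p.1 + p.2 + 1),
      Nat.sum_antidiagonal_eq_sum_range_succ_mk]
    refine sum_congr rfl fun n hn => ?_
    rw [Nat.add_sub_cancel' (Nat.lt_succ_iff.1 (mem_range.1 hn))]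
  calc ∑' n, ∑' k, h n (n + k + 1)
      = ∑' p : ℕ × ℕ, h p.1 (p.1 + p.2 + 1) := ENNReal.tsum_prod.symm
    _ = ∑' a, ∑' p : antidiagonal a, h p.1.1 (p.1.1 + p.1.2 + 1) :=
      (HasAntidiagonal.sigmaAntidiagonalEquivProd.tsum_eq _).symm.trans (ENNReal.tsum_sigma' _)
    _ = ∑' a, ∑ n ∈ range (a + 1), h n (a + 1) := tsum_congr hfiber
    _ = ∑' a, ∑ n ∈ range a, h n a := by
      rw [tsum_eq_zero_add' (f := fun a => ∑ n ∈ range a, h n a) ENNReal.summable, range_zero,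
        sum_empty, zero_add]

/-- The connected sum of two nonnegative sequences. -/
def connectedSum (t : ℝ) (f g : ℕ → ℝ) : ℝ≥0∞ :=
  ∑' (m : ℕ) (n : ℕ), ENNReal.ofReal (f m * connector t m n * g n)

theorem connectedSum_comm (t : ℝ) (f g : ℕ → ℝ) : connectedSum t f g = connectedSum t g f := by
  rw [connectedSum, ENNReal.tsum_comm, connectedSum]
  refine tsum_congr fun m => tsum_congr fun n => ?_
  rw [connector_comm]
  congr 1
  ring

theorem connectedSum_single_zero (ht : t < 1) (f : ℕ → ℝ) :
    connectedSum t f (Pi.single 0 1) = ∑' m, ENNReal.ofReal (f m) := by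
  refine tsum_congr fun m => ?_
  rw [tsum_eq_single 0 fun n hn => by simp [hn], connector_zero_right ht, Pi.single_eq_same,
    mul_one, mul_one]

theorem connectedSum_letterOperator_X (ht0 : 0 ≤ t) (ht : t < 1) {f g : ℕ → ℝ} (hf0 : f 0 = 0)
    (hf : 0 ≤ f) (hg : 0 ≤ g) :
    connectedSum t (letterOperator t Letter.X f) g =
      connectedSum t f (letterOperator t Letter.Y g) := by
  refine tsum_congr fun m => ?_
  rcases m.eq_zero_or_pos with rfl | hm
  · simp [letterOperator, hf0]
  have hfg (n : ℕ) : 0 ≤ f m * g n := mul_nonneg (hf m) (hg n)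
  have hX (n : ℕ) : ENNReal.ofReal (f m / m * connector t m n * g n) =
      ∑' k : ℕ, ENNReal.ofReal
        (f m * g n * (connector t m (n + k + 1) / ((n + k + 1 : ℕ) - t))) := by
    have h := (hasSum_connector ht0 ht hm n).mul_left (f m * g n)
    rw [← ENNReal.ofReal_tsum_of_nonneg (fun k =>
      mul_nonneg (hfg n) (connector_div_nonneg ht m (n + k).succ_pos)) h.summable, h.tsum_eq]
    congr 1
    ring
  have hY (a : ℕ) : ENNReal.ofReal (f m * connector t m a * ((∑ n ∈ range a, g n) / (a - t))) =
      ∑ n ∈ range a, ENNReal.ofReal (f m * g n * (connector t m a / (a - t))) := by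
    rw [← ENNReal.ofReal_sum_of_nonneg fun n hn =>
      mul_nonneg (hfg n) (connector_div_nonneg ht m (Nat.zero_lt_of_lt (mem_range.1 hn))),
      ← sum_mul, ← mul_sum]
    congr 1
    ring
  exact (tsum_congr hX).trans ((tsum_tsum_add_succ fun n a =>
    ENNReal.ofReal (f m * g n * (connector t m a / (a - t)))).trans (tsum_congr hY).symm)

theorem connectedSum_letterOperator_Y (ht0 : 0 ≤ t) (ht : t < 1) {f g : ℕ → ℝ} (hg0 : g 0 = 0)
    (hf : 0 ≤ f) (hg : 0 ≤ g) :
    connectedSum t (letterOperator t Letter.Y f) g =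
      connectedSum t f (letterOperator t Letter.X g) := by
  rw [connectedSum_comm, ← connectedSum_letterOperator_X ht0 ht hg0 hg hf, connectedSum_comm]

theorem nestedSum_word_apply_zero (t : ℝ) {u : List Letter} (hu : u ≠ []) :
    nestedSum t (word u) 0 = 0 := by
  match u, hu with
  | Letter.X :: u, _ => rw [word_x_cons, nestedSum_x_mul_apply, Nat.cast_zero, div_zero]
  | Letter.Y :: u, _ => rw [word_y_cons, nestedSum_y_mul_apply, range_zero, sum_empty, zero_div]

theorem connectedSum_word_append_Y (ht0 : 0 ≤ t) (ht : t < 1) (u : List Letter) {v : List Letter}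
    (hv : v ≠ []) :
    connectedSum t (nestedSum t (word (u ++ [Letter.Y]))) (nestedSum t (word v)) =
      connectedSum t (nestedSum t 1) (nestedSum t (dual (word (u ++ [Letter.Y])) * word v)) := by
  have hnonneg : ∀ u, 0 ≤ nestedSum t (word u) := nestedSum_word_nonneg ht
  induction u generalizing v with
  | nil =>
    rw [List.nil_append, word_y_cons, nestedSum_y_mul, connectedSum_letterOperator_Y ht0 ht
      (nestedSum_word_apply_zero t hv) (hnonneg _) (hnonneg v), ← nestedSum_x_mul, word_nil,
      mul_one, dual_y]
  | cons a u ih =>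
    cases a with
    | X =>
      rw [List.cons_append, word_x_cons, nestedSum_x_mul, connectedSum_letterOperator_X ht0 ht
        (nestedSum_word_apply_zero t (by simp)) (hnonneg _) (hnonneg v), ← nestedSum_y_mul,
        ← word_y_cons, ih (by simp), word_y_cons, dual_mul, dual_x, mul_assoc]
    | Y =>
      rw [List.cons_append, word_y_cons, nestedSum_y_mul, connectedSum_letterOperator_Y ht0 ht
        (nestedSum_word_apply_zero t hv) (hnonneg _) (hnonneg v), ← nestedSum_x_mul,
        ← word_x_cons, ih (by simp), word_x_cons, dual_mul, dual_y, mul_assoc]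

theorem tsum_ofReal_nestedSum_dual (ht0 : 0 ≤ t) (ht : t < 1) (u : List Letter) :
    ∑' m, ENNReal.ofReal (nestedSum t (dual (x * word u * y)) m) =
      ∑' m, ENNReal.ofReal (nestedSum t (x * word u * y) m) := by
  have hnonneg : ∀ u, 0 ≤ nestedSum t (word u) := nestedSum_word_nonneg ht
  have hY : word [Letter.Y] = y := by rw [word_y_cons, word_nil, mul_one]
  rw [← connectedSum_single_zero ht, ← connectedSum_single_zero ht, ← nestedSum_one t,
    x_mul_word_mul_y_eq, nestedSum_x_mul, ← word_nil, connectedSum_letterOperator_X ht0 ht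
      (nestedSum_word_apply_zero t (by simp)) (hnonneg _) (hnonneg []), ← nestedSum_y_mul,
    ← word_y_cons, connectedSum_word_append_Y ht0 ht u (by simp), connectedSum_comm, hY, dual_mul,
    dual_x, word_nil]

theorem tsum_nestedSum_dual (ht0 : 0 ≤ t) (ht : t < 1) (u : List Letter) :
    ∑' m, nestedSum t (dual (x * word u * y)) m = ∑' m, nestedSum t (x * word u * y) m := by
  have hw : x * word u * y = word (Letter.X :: (u ++ [Letter.Y])) := by
    rw [x_mul_word_mul_y_eq, word_x_cons]
  obtain ⟨v, hv⟩ := exists_dual_word_eq (Letter.X :: (u ++ [Letter.Y]))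
  have htoReal (u : List Letter) : ∑' m, nestedSum t (word u) m =
      (∑' m, ENNReal.ofReal (nestedSum t (word u) m)).toReal := by
    rw [ENNReal.tsum_toReal_eq fun m => ENNReal.ofReal_ne_top]
    exact tsum_congr fun m => (ENNReal.toReal_ofReal (nestedSum_word_nonneg ht u m)).symm
  have h := tsum_ofReal_nestedSum_dual ht0 ht u
  rw [hw, hv] at h ⊢
  rw [htoReal, htoReal, h]

end ConnectedSums

section Series

open Filter Topology

theorem eq_zero_of_frequently_hasSum_pow_mul {𝕜 : Type*} [NontriviallyNormedField 𝕜]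
    [CompleteSpace 𝕜] {d : ℕ → 𝕜} (h : ∃ᶠ t in 𝓝[≠] (0 : 𝕜), HasSum (fun n => t ^ n * d n) 0) :
    d = 0 := by
  set p := FormalMultilinearSeries.ofScalars 𝕜 d
  have hp (t : 𝕜) : p.sum t = ∑' n, t ^ n * d n := by
    refine (FormalMultilinearSeries.ofScalars_sum_eq d t).trans ?_
    simp only [smul_eq_mul, mul_comm]
  obtain ⟨t, ht, ht0⟩ := (h.and_eventually self_mem_nhdsWithin).exists
  have hradius : 0 < p.radius := by
    have ht_pos : (0 : ENNReal) < ‖t‖₊ := by simpa using ht0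
    refine ht_pos.trans_le (p.le_radius_of_tendsto (l := 0) ?_)
    simpa [p, FormalMultilinearSeries.ofScalars_norm, mul_comm] using
      ht.summable.tendsto_atTop_zero.norm
  have hseries := (p.hasFPowerSeriesOnBall hradius).hasFPowerSeriesAt
  have hzero : ∀ᶠ t in 𝓝 0, p.sum t = 0 :=
    hseries.analyticAt.frequently_zero_iff_eventually_zero.1
      (h.mono fun t ht => (hp t).trans ht.tsum_eq)
  exact (FormalMultilinearSeries.ofScalars_series_eq_zero 𝕜).1
    (hseries.eq_zero_of_eventually hzero)

theorem eq_of_frequently_hasSum_pow_mul {𝕜 : Type*} [NontriviallyNormedField 𝕜]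
    [CompleteSpace 𝕜] {a b : ℕ → 𝕜} {f : 𝕜 → 𝕜} (h : ∃ᶠ t in 𝓝[≠] (0 : 𝕜),
      HasSum (fun n => t ^ n * a n) (f t) ∧ HasSum (fun n => t ^ n * b n) (f t)) :
    a = b := by
  refine sub_eq_zero.1 (eq_zero_of_frequently_hasSum_pow_mul (h.mono fun t ht => ?_))
  simpa [mul_sub] using ht.1.sub ht.2

theorem hasSum_sum_antidiagonal_mul {R : Type*} [NormedRing R] [CompleteSpace R] {a b : ℕ → R}
    {s t : R} (ha : HasSum a s) (hb : HasSum b t) (ha' : Summable fun n => ‖a n‖)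
    (hb' : Summable fun n => ‖b n‖) :
    HasSum (fun n => ∑ p ∈ antidiagonal n, a p.1 * b p.2) (s * t) := by
  rw [← ha.tsum_eq, ← hb.tsum_eq, tsum_mul_tsum_eq_tsum_sum_antidiagonal_of_summable_norm ha' hb']
  exact (summable_norm_sum_mul_antidiagonal_of_summable_norm ha' hb').of_norm.hasSum

theorem hasSum_of_hasSum_swap {α β : Type*} {f : α → β → ℝ} {g : α → ℝ} {h : β → ℝ} {s : ℝ}
    (hf : ∀ a b, 0 ≤ f a b) (hg : ∀ a, HasSum (f a) (g a)) (hs : HasSum g s)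
    (hh : ∀ b, HasSum (fun a => f a b) (h b)) : HasSum h s := by
  have hsum : Summable fun p : α × β => f p.1 p.2 := by
    refine (summable_prod_of_nonneg fun p => hf p.1 p.2).2 ⟨fun a => (hg a).summable, ?_⟩
    simpa only [(hg _).tsum_eq] using hs.summable
  have hprod : HasSum (fun p : α × β => f p.1 p.2) s := by
    rw [hs.unique (hsum.hasSum.prod_fiberwise hg)]
    exact hsum.hasSum
  exact ((Equiv.prodComm β α).hasSum_iff.2 hprod).prod_fiberwise hh

end Series

section OhnoRelation

open Filter Topology

theorem hasSum_pow_mul_one_div_pow {t m : ℝ} (ht : |t| < m) :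
    HasSum (fun n : ℕ => t ^ n * (1 / m ^ (n + 1))) (1 / (m - t)) := by
  have hm : 0 < m := (abs_nonneg t).trans_lt ht
  have hlt : |t / m| < 1 := by rwa [abs_div, abs_of_pos hm, div_lt_one hm]
  have hterm (n : ℕ) : t ^ n * (1 / m ^ (n + 1)) = (t / m) ^ n / m := by
    rw [div_pow, pow_succ, mul_one_div, div_div]
  have hlimit : 1 / (m - t) = (1 - t / m)⁻¹ / m := by
    rw [inv_eq_one_div, div_div, sub_mul, one_mul, div_mul_cancel₀ _ hm.ne']
  simpa only [hterm, hlimit] using (hasSum_geometric_of_abs_lt_one hlt).div_const m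

theorem nestedSum_ohnoCoeff_y_mul_apply (n : ℕ) (w : H) (m : ℕ) :
    nestedSum 0 (ohnoCoeff n (y * w)) m =
      ∑ p ∈ antidiagonal n, 1 / (m : ℝ) ^ (p.1 + 1) *
        ∑ j ∈ range m, nestedSum 0 (ohnoCoeff p.2 w) j := by
  rw [ohnoCoeff_mul, map_sum, Finset.sum_apply]
  refine sum_congr rfl fun p _ => ?_
  rw [ohnoCoeff_y, mul_assoc, nestedSum_x_pow_mul_apply, nestedSum_y_mul_apply, sub_zero, div_div,
    ← pow_succ', one_div_mul_eq_div]

theorem nestedSum_ohnoCoeff_word_nonneg (n : ℕ) (u : List Letter) (m : ℕ) :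
    0 ≤ nestedSum 0 (ohnoCoeff n (word u)) m := by
  induction u generalizing n m with
  | nil =>
    rw [word_nil, ohnoCoeff_one]
    split
    · exact nestedSum_word_nonneg one_pos [] m
    · simp
  | cons a u ih =>
    cases a with
    | X =>
      rw [word_x_cons, ohnoCoeff_x_mul, nestedSum_x_mul_apply]
      exact div_nonneg (ih n m) m.cast_nonneg
    | Y =>
      rw [word_y_cons, nestedSum_ohnoCoeff_y_mul_apply]
      exact sum_nonneg fun p _ => mul_nonneg (by positivity) (sum_nonneg fun j _ => ih p.2 j)

theorem hasSum_nestedSum_ohnoCoeff {t : ℝ} (ht : |t| < 1) (u : List Letter) (m : ℕ) :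
    HasSum (fun n => t ^ n * nestedSum 0 (ohnoCoeff n (word u)) m) (nestedSum t (word u) m) := by
  induction u generalizing m with
  | nil =>
    have h := hasSum_single (f := fun n => t ^ n * nestedSum 0 (ohnoCoeff n (word [])) m) 0
      fun n hn => by simp [word_nil, ohnoCoeff_one, hn]
    simpa [word_nil, ohnoCoeff_one, nestedSum_one] using h
  | cons a u ih =>
    cases a with
    | X =>
      simpa only [word_x_cons, ohnoCoeff_x_mul, nestedSum_x_mul_apply, mul_div_assoc] using
        (ih m).div_const (m : ℝ)
    | Y =>
      rw [word_y_cons, nestedSum_y_mul_apply]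
      rcases m.eq_zero_or_pos with rfl | hm
      · simp [nestedSum_ohnoCoeff_y_mul_apply, hasSum_zero]
      have hgeom := hasSum_pow_mul_one_div_pow (ht.trans_le (Nat.one_le_cast.2 hm))
      have hsum := hasSum_sum (s := range m) fun j _ => ih j
      rw [← one_div_mul_eq_div]
      refine (hasSum_sum_antidiagonal_mul hgeom hsum hgeom.summable.norm
        hsum.summable.norm).congr_fun fun n => ?_
      rw [nestedSum_ohnoCoeff_y_mul_apply, mul_sum]
      refine sum_congr rfl fun p hp => ?_
      rw [← (HasAntidiagonal.mem_antidiagonal.1 hp), pow_add, ← mul_sum]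
      ring

theorem hasSum_zetaMap_ohnoCoeff {t : ℝ} (ht0 : 0 ≤ t) (ht : t ≤ 1 / 2) (u : List Letter) :
    HasSum (fun n => t ^ n * zetaMap (ohnoCoeff n (x * word u * y)))
      (∑' m, nestedSum t (x * word u * y) m) := by
  have hword : x * word u * y = word (Letter.X :: (u ++ [Letter.Y])) := by
    rw [x_mul_word_mul_y_eq, word_x_cons]
  have hsummable : Summable (nestedSum t (x * word u * y)) := by
    rw [x_mul_word_mul_y_eq]
    exact summable_nestedSum_x_mul_word ht _
  refine hasSum_of_hasSum_swap
    (f := fun m n => t ^ n * nestedSum 0 (ohnoCoeff n (x * word u * y)) m)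
    (fun m n => ?_) (fun m => ?_) hsummable.hasSum fun n =>
      (hasSum_nestedSum (ohnoCoeff_mem_H0 n (x_mul_mul_y_mem_H0 _))).mul_left (t ^ n)
  · rw [hword]
    exact mul_nonneg (pow_nonneg ht0 n) (nestedSum_ohnoCoeff_word_nonneg n _ m)
  · rw [hword]
    exact hasSum_nestedSum_ohnoCoeff (by rw [abs_of_nonneg ht0]; linarith) _ m

theorem zetaMap_ohnoCoeff_dual (n : ℕ) {w : H} (hw : w ∈ H0) :
    zetaMap (ohnoCoeff n (dual w)) = zetaMap (ohnoCoeff n w) := by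
  rw [H0_eq_span] at hw
  refine LinearMap.eqOn_span (f := zetaMap ∘ₗ ohnoCoeff n ∘ₗ dual) (g := zetaMap ∘ₗ ohnoCoeff n)
    ?_ hw
  rintro _ (rfl | ⟨u, rfl⟩)
  · simp only [LinearMap.comp_apply, dual_one]
  obtain ⟨v, hv⟩ := exists_dual_word_eq u
  have hdual : dual (x * word u * y) = x * word v * y := by
    rw [dual_mul, dual_mul, dual_x, dual_y, hv, mul_assoc]
  suffices h : (fun n => zetaMap (ohnoCoeff n (x * word v * y))) =
      fun n => zetaMap (ohnoCoeff n (x * word u * y)) by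
    simpa only [LinearMap.comp_apply, hdual] using congrFun h n
  refine eq_of_frequently_hasSum_pow_mul (f := fun t => ∑' m, nestedSum t (x * word u * y) m) ?_
  have hpos : ∃ᶠ t : ℝ in 𝓝[>] 0, 0 < t ∧ t ≤ 1 / 2 :=
    Filter.Eventually.frequently (Ioc_mem_nhdsGT one_half_pos)
  refine (hpos.filter_mono (nhdsWithin_mono _ fun t ht => ne_of_gt ht)).mono ?_
  rintro t ⟨ht0, ht⟩
  refine ⟨?_, hasSum_zetaMap_ohnoCoeff ht0.le ht u⟩
  rw [← tsum_nestedSum_dual ht0.le (by linarith), hdual]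
  exact hasSum_zetaMap_ohnoCoeff ht0.le ht v

end OhnoRelation

section DerivationRelation

theorem zetaMap_dual {w : H} (hw : w ∈ H0) : zetaMap (dual w) = zetaMap w := by
  simpa only [ohnoCoeff_zero] using zetaMap_ohnoCoeff_dual 0 hw

theorem zetaMap_coeff_dualOhnoHom (n : ℕ) {w : H} (hw : w ∈ H0) :
    zetaMap (coeff n (dualOhnoHom w)) = zetaMap (ohnoCoeff n w) := by
  rw [coeff_dualOhnoHom, zetaMap_dual (ohnoCoeff_mem_H0 n (dual_mem_H0 hw)),
    zetaMap_ohnoCoeff_dual n hw]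

theorem zetaMap_coeff_derivationExp_succ (n : ℕ) {w : H} (hw : w ∈ H0) :
    zetaMap (coeff (n + 1) (derivationExp w)) = 0 := by
  induction n using Nat.strong_induction_on generalizing w with
  | _ n ih =>
    have hOhno := zetaMap_coeff_dualOhnoHom (n + 1) hw
    rw [← seriesExtension_derivationExp_comp_ohnoHom, AlgHom.comp_apply, coeff_seriesExtension,
      map_sum, Nat.sum_antidiagonal_succ, coeff_zero_derivationExp, ← ohnoCoeff_apply,
      add_eq_left] at hOhno
    rw [sum_eq_single (n, 0)] at hOhno
    · simpa only [← ohnoCoeff_apply, ohnoCoeff_zero] using hOhno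
    · rintro ⟨i, j⟩ hij hne
      have hlt : i < n := by grind [HasAntidiagonal.mem_antidiagonal]
      exact ih i hlt (ohnoCoeff_mem_H0 j hw)
    · simp

theorem zetaMap_partialD_succ (n : ℕ) {w : H} (hw : w ∈ H0) :
    zetaMap (partialD (n + 1) w) = 0 := by
  have h := congrArg (fun f => zetaMap (coeff (n + 1) f)) (eulerOperator_derivationExp w)
  simp only [coeff_eulerOperator, map_nsmul, zetaMap_coeff_derivationExp_succ n hw, smul_zero,
    coeff_succ_X_mul, coeff_seriesExtension, map_sum, coeff_derivationSeries] at h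
  rw [sum_eq_single (0, n), coeff_zero_derivationExp] at h
  · exact h.symm
  · rintro ⟨i, j⟩ hij hne
    have hi : i ≠ 0 := by grind [HasAntidiagonal.mem_antidiagonal]
    obtain ⟨i, rfl⟩ := Nat.exists_eq_succ_of_ne_zero hi
    exact zetaMap_coeff_derivationExp_succ i (partialD_mem_H0 (j + 1) hw)
  · simp

end DerivationRelation

end MZV

end

theorem theorem1 (l : ℕ) (hl : 1 ≤ l) (w : MZV.H) (hw : w ∈ MZV.H0) :
    MZV.Z ⟨MZV.partialD l w, MZV.partialD_mem_H0 l hw⟩ = 0 := by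
  obtain ⟨n, rfl⟩ := Nat.exists_eq_add_of_le' hl
  rw [MZV.Z_eq_zetaMap]
  exact MZV.zetaMap_partialD_succ n hw
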